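/- Let $N=2^n=LM$ with positive integers $L,M$, let $\mathbf F_N=\left[\begin{smallmatrix}1&0\\1&1\end{smallmatrix}\right]^{\otimes n}$ over $\{0,1\}=\mathbb F_2$, let $\mathcal A\subseteq\{1,\dots,N\}$ with $|\mathcal A|=K$ be the information set, and let arbitrary fixed values of the frozen bits $u_j$, $j\notin\mathcal A$, be given. The information bits $u_i$, $i\in\mathcal A$, are independent and uniform. The codeword $\mathbf x=u_1^N\mathbf F_N$ is split into $L$ consecutive blocks of length $M$ (block mapping, $x_{l,k}=x_{(l-1)M+k}$) and sent over the block Rayleigh fading channel $$y_{l,k}=\alpha_l\sqrt{E_s}\,(1-2x_{l,k})+n_{l,k},\qquad 1\le l\le L,\ 1\le k\le M,$$ where $E_s,N_0>0$, the $n_{l,k}$ are Gaussian with mean $0$ and variance $N_0/2$, the $\alpha_l$ are Rayleigh distributed with density $\frac{\alpha}{\sigma^2}e^{-\alpha^2/(2\sigma^2)}$ ($\alpha\ge0$) and $\sigma>0$, $\mathbb E(\alpha_l^2)=2\sigma^2=1$, and all these random variables and the information bits are independent. The receiver knows $\boldsymbol\alpha=(\alpha_1,\dots,\alpha_L)$ and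 uses successive cancellation (SC) decoding: for $i=1,\dots,N$ in order, $\hat u_i=u_i$ if $i\notin\mathcal A$; if $i\in\mathcal A$, then $\hat u_i=0$ when $W_N^{(i)}(\mathbf y,\hat u_1^{i-1}\mid 0,\boldsymbol\alpha)\ge W_N^{(i)}(\mathbf y,\hat u_1^{i-1}\mid 1,\boldsymbol\alpha)$ and $\hat u_i=1$ otherwise, where $$W_N^{(i)}(\mathbf y,v_1^{i-1}\mid v_i,\boldsymbol\alpha)=\frac1{2^{N-1}}\sum_{v_{i+1}^N\in\{0,1\}^{N-i}}W_N(\mathbf y\mid v_1^N\mathbf F_N,\boldsymbol\alpha),$$ $$W_N(\mathbf y\mid\mathbf x,\boldsymbol\alpha)=(\pi N_0)^{-N/2}\prod_{l=1}^L\prod_{k=1}^M\exp\Big(-\tfrac{(y_{l,k}-\alpha_l\sqrt{E_s}(1-2x_{l,k}))^2}{N_0}\Big).$$ Let $P_e(N,K,\mathcal A)=\Pr(\hat u_1^N\ne u_1^N)$ be the block error probability. For $1\le i\le N$ let $\mathbb D_N^{(i)}=\{(0_1^{i-1},1,u_{i+1}^N)\mathbf F_N: u_{i+1}^N\in\{0,1\}^{N-i}\}$,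 let $d_{\min}^{(i)}$ be the minimum Hamming weight of its elements, and for $\mathbf d=(d_1,\dots,d_L)\in\{0,1,\dots,M\}^L$ let $A_N^{(i)}(\mathbf d)$ be the number of $\mathbf c\in\mathbb D_N^{(i)}$ whose $l$-th block has Hamming weight $d_l$ for every $l$. Then $$P_e(N,K,\mathcal A)\le\sum_{i\in\mathcal A}\ \sum_{\substack{\mathbf d\in\{0,\dots,M\}^L\\ d_{\min}^{(i)}\le d_1+\cdots+d_L\le N}}A_N^{(i)}(\mathbf d)\prod_{l=1}^L\frac1{1+d_l\,E_s/N_0}.$$ -/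

import Mathlib

open MeasureTheory ProbabilityTheory

/-! Conventions: `N = 2 ^ n` is the code length, indices are 0-based, bits live in `ZMod 2`.
`L` is the number of fading blocks, `M` the block length, `L * M = 2 ^ n`. -/

namespace PolarBlockFading

/-- The kernel `F₂ = [1 0; 1 1]`. -/
def kernelF2 : Matrix (Fin 2) (Fin 2) (ZMod 2) := !![1, 0; 1, 1]

/-- The identification of a pair of indices with one index, `(a, b) ↦ 2 ^ n * a + b`. -/
def kronIndex (n : ℕ) : Fin 2 × Fin (2 ^ n) ≃ Fin (2 ^ (n + 1)) :=
  finProdFinEquiv.trans (finCongr (pow_succ' 2 n).symm)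

/-- The polar generator matrix `F_N = F₂^{⊗ n}`, `N = 2 ^ n`. -/
def polarMatrix : (n : ℕ) → Matrix (Fin (2 ^ n)) (Fin (2 ^ n)) (ZMod 2)
  | 0 => 1
  | n + 1 => (Matrix.kroneckerMap (fun a b => a * b) kernelF2 (polarMatrix n)).submatrix
      (kronIndex n).symm (kronIndex n).symm

/-- Polar encoding `x = u F_N`. -/
def encode {n : ℕ} (u : Fin (2 ^ n) → ZMod 2) : Fin (2 ^ n) → ZMod 2 :=
  Matrix.vecMul u (polarMatrix n)

/-- The `i`-th polar subcode: the codewords `(0, …, 0, 1, u_{i+1}, …, u_N) F_N`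
with the leading one at position `i`. -/
def polarSubcode {n : ℕ} (i : Fin (2 ^ n)) : Finset (Fin (2 ^ n) → ZMod 2) :=
  (Finset.univ.filter fun u : Fin (2 ^ n) → ZMod 2 => (∀ j, j < i → u j = 0) ∧ u i = 1).image
    encode

/-- The minimum Hamming weight of the `i`-th polar subcode, that is, its minimum Hamming distance
to the all-zero codeword. -/
noncomputable def polarMinWeight {n : ℕ} (i : Fin (2 ^ n)) : ℕ :=
  sInf {w : ℕ | ∃ c ∈ polarSubcode i, hammingNorm c = w}

variable {n L M : ℕ}

/-- Block mapping: the `k`-th bit of block `l` of a vector of length `N = L M` is its entry number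
`M * l + k`. -/
def toBlocks (hN : L * M = 2 ^ n) (x : Fin (2 ^ n) → ZMod 2) (l : Fin L) (k : Fin M) : ZMod 2 :=
  x (Fin.cast hN (finProdFinEquiv (l, k)))

/-- The split polar weight enumerator `A_N^{(i)}(d₁, …, d_L)`: the number of codewords of the
`i`-th polar subcode with Hamming weight `d l` on each block `l`. -/
def splitEnumerator (hN : L * M = 2 ^ n) (i : Fin (2 ^ n)) (d : Fin L → ℕ) : ℕ :=
  ((polarSubcode i).filter fun c => ∀ l, hammingNorm (toBlocks hN c l) = d l).card

/-- The weight partition vectors `d` with `0 ≤ d l ≤ M` and total weight between the minimum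
weight of the `i`-th polar subcode and `N`. -/
noncomputable def weightPartitions (L M : ℕ) (i : Fin (2 ^ n)) : Finset (Fin L → ℕ) :=
  (Fintype.piFinset fun _ : Fin L => Finset.range (M + 1)).filter fun d =>
    polarMinWeight i ≤ ∑ l, d l ∧ ∑ l, d l ≤ 2 ^ n

/-- BPSK modulation `s = √E_s (1 - 2 x)`. -/
noncomputable def bpsk (Es : ℝ) (x : ZMod 2) : ℝ := Real.sqrt Es * (1 - 2 * (x.val : ℝ))

/-- The received signal `y_{l,k} = α_l s_{l,k} + n_{l,k}` when the codeword `x` is sent through the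
block mapping, with fading coefficients `α` and noise `z`. -/
noncomputable def received (hN : L * M = 2 ^ n) (Es : ℝ) (x : Fin (2 ^ n) → ZMod 2)
    (α : Fin L → ℝ) (z : Fin L → Fin M → ℝ) (l : Fin L) (k : Fin M) : ℝ :=
  α l * bpsk Es (toBlocks hN x l k) + z l k

/-- The Rayleigh density with parameter `σ`. -/
noncomputable def rayleighPDF (σ a : ℝ) : ℝ :=
  if 0 ≤ a then a / σ ^ 2 * Real.exp (-(a ^ 2 / (2 * σ ^ 2))) else 0

/-- The Rayleigh distribution with parameter `σ`. -/
noncomputable def rayleighMeasure (σ : ℝ) : Measure ℝ :=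
  volume.withDensity fun a => ENNReal.ofReal (rayleighPDF σ a)

/-- The joint law of the fading and the noise: independent Rayleigh coefficients `α_l` with
parameter `σ`, and, independent of them, independent real Gaussian noise samples of mean `0` and
variance `N₀ / 2`. -/
noncomputable def channelLaw (L M : ℕ) (σ N0 : ℝ) :
    Measure ((Fin L → ℝ) × (Fin L → Fin M → ℝ)) :=
  (Measure.pi fun _ : Fin L => rayleighMeasure σ).prod
    (Measure.pi fun _ : Fin L => Measure.pi fun _ : Fin M =>
      gaussianReal 0 (N0 / 2).toNNReal)

/-- The transition density `W_N(y | x, α)`. -/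
noncomputable def transition (hN : L * M = 2 ^ n) (Es N0 : ℝ) (α : Fin L → ℝ)
    (y : Fin L → Fin M → ℝ) (x : Fin (2 ^ n) → ZMod 2) : ℝ :=
  1 / (Real.pi * N0) ^ ((2 ^ n : ℝ) / 2) *
    ∏ l, ∏ k, Real.exp (-((y l k - α l * bpsk Es (toBlocks hN x l k)) ^ 2 / N0))

/-- The transition density `W_N^{(i)}(y, v_1^{i-1} | b, α)` of the `i`-th polarized channel; only
the entries of `v` before position `i` are used. -/
noncomputable def polarized (hN : L * M = 2 ^ n) (Es N0 : ℝ) (α : Fin L → ℝ)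
    (y : Fin L → Fin M → ℝ) (i : Fin (2 ^ n)) (v : Fin (2 ^ n) → ZMod 2) (b : ZMod 2) : ℝ :=
  1 / 2 ^ (2 ^ n - 1) *
    ∑ u ∈ Finset.univ.filter
      (fun u : Fin (2 ^ n) → ZMod 2 => (∀ j, j < i → u j = v j) ∧ u i = b),
      transition hN Es N0 α y (encode u)

/-- Successive cancellation decoding with known fading coefficients `α`: bits outside the
information set `A` are set to their frozen values, and a bit `i ∈ A` is decided by comparing the
likelihoods of `0` and `1` over the `i`-th polarized channel, given the previous decisions
(`0` is chosen in case of a tie). -/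
noncomputable def scDecode (hN : L * M = 2 ^ n) (Es N0 : ℝ) (A : Finset (Fin (2 ^ n)))
    (frozen : Fin (2 ^ n) → ZMod 2) (α : Fin L → ℝ) (y : Fin L → Fin M → ℝ)
    (i : Fin (2 ^ n)) : ZMod 2 :=
  let prev : Fin (2 ^ n) → ZMod 2 := fun j =>
    if _h : j < i then scDecode hN Es N0 A frozen α y j else 0
  open Classical in
  if i ∈ A then
    if polarized hN Es N0 α y i prev 1 ≤ polarized hN Es N0 α y i prev 0 then 0 else 1
  else frozen i
termination_by i

/-- The source block with information bits `m` on `A` and frozen values elsewhere. -/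
def sourceBlock (A : Finset (Fin (2 ^ n))) (frozen : Fin (2 ^ n) → ZMod 2) (m : A → ZMod 2)
    (j : Fin (2 ^ n)) : ZMod 2 :=
  if h : j ∈ A then m ⟨j, h⟩ else frozen j

/-- The block error probability under SC decoding: the probability, over uniformly distributed
information bits, fading and noise, that the decoded source block differs from the sent one. -/
noncomputable def blockErrorProbability (hN : L * M = 2 ^ n) (σ Es N0 : ℝ)
    (A : Finset (Fin (2 ^ n))) (frozen : Fin (2 ^ n) → ZMod 2) : ℝ :=
  (∑ m : A → ZMod 2, (channelLaw L M σ N0).real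
    {p | scDecode hN Es N0 A frozen p.1
        (received hN Es (encode (sourceBlock A frozen m)) p.1 p.2)
      ≠ sourceBlock A frozen m}) / 2 ^ A.card

end PolarBlockFading

namespace PolarBlockFading

/-! ### Products of integrals -/

/-! At the first wrong decision the earlier decisions are correct and the index lies in `A`, so the
likelihoods compared there are those of the decoder that is told the true past. Flipping the
received signs by the sent codeword moves the comparison to the all-zero codeword (`polarized_eq`,
`flip_received`), and the symmetric noise law is unchanged (`measurePreserving_flip`). A block error
thus lies in a union over `A` of events of the same probabilities as `bitErrorEvent`, whatever the
message (`exists_first_error`).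

Such an event compares two sums of likelihoods, so it is not contained in the union of pairwise
comparisons of codewords. Instead, for fixed fading, the error probability is averaged over the
codewords of `inputCoset i 0`, which all share it. On the error region the likelihood sum `S₀` is at
most `√(S₀ S₁)`, and subadditivity of the root leaves a double sum of Bhattacharyya integrals. These
depend only on the difference of the two codewords, so one sum cancels the averaging and the other
runs over the polar subcode (`noiseLaw_bitErrorEvent_le`). Each coefficient is a product of `exp
(-d_l (E_s / N₀) α_l²)`, and the Rayleigh average of each factor is `1 / (1 + d_l E_s / N₀)`.
Grouping codewords by block weights gives the bound. -/

theorem lintegral_pi_ofReal_prod {ι : Type*} [Fintype ι] {X : ι → Type*}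
    [∀ i, MeasurableSpace (X i)] (μ : ∀ i, Measure (X i)) [∀ i, SigmaFinite (μ i)]
    (f : ∀ i, X i → ℝ) (hf : ∀ i x, 0 ≤ f i x) (hi : ∀ i, Integrable (f i) (μ i)) :
    ∫⁻ x, ENNReal.ofReal (∏ i, f i (x i)) ∂(Measure.pi μ)
      = ∏ i, ∫⁻ x, ENNReal.ofReal (f i x) ∂(μ i) := by
  rw [← ofReal_integral_eq_lintegral_ofReal (Integrable.fintype_prod_dep hi)
    (ae_of_all _ fun x => Finset.prod_nonneg fun i _ => hf i _),
    integral_fintype_prod_eq_prod, ENNReal.ofReal_prod_of_nonneg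
      fun i _ => integral_nonneg (hf i)]
  exact Finset.prod_congr rfl fun i _ =>
    ofReal_integral_eq_lintegral_ofReal (hi i) (ae_of_all _ (hf i))

theorem pi_withDensity_ofReal {ι : Type*} [Fintype ι] {X : ι → Type*}
    [∀ i, MeasurableSpace (X i)] (μ : ∀ i, Measure (X i)) [∀ i, SigmaFinite (μ i)]
    (f : ∀ i, X i → ℝ) (hf : ∀ i x, 0 ≤ f i x) (hi : ∀ i, Integrable (f i) (μ i)) :
    Measure.pi (fun i => (μ i).withDensity fun x => ENNReal.ofReal (f i x))
      = (Measure.pi μ).withDensity fun x => ENNReal.ofReal (∏ i, f i (x i)) := by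
  have (i : ι) : IsFiniteMeasure ((μ i).withDensity fun x => ENNReal.ofReal (f i x)) :=
    isFiniteMeasure_withDensity_ofReal (hi i).2
  refine (Measure.pi_eq fun s hs => ?_)
  rw [withDensity_apply _ (MeasurableSet.univ_pi hs), Measure.restrict_pi_pi,
    lintegral_pi_ofReal_prod _ f hf fun i => (hi i).restrict]
  exact Finset.prod_congr rfl fun i _ => (withDensity_apply _ (hs i)).symm

/-! ### Polar encoding -/

/-- The kernel is an involution over `ZMod 2`, and Kronecker powers inherit this. It makes encoding
injective, so sums over inputs are sums over codewords. -/
theorem polarMatrix_mul_self : ∀ n, polarMatrix n * polarMatrix n = 1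
  | 0 => by simp [polarMatrix]
  | n + 1 => by
    have h2 : kernelF2 * kernelF2 = 1 := by decide
    have := Matrix.mul_kronecker_mul kernelF2 kernelF2 (polarMatrix n) (polarMatrix n)
    rw [polarMatrix, Matrix.submatrix_mul_equiv, ← this, h2, polarMatrix_mul_self n,
      Matrix.one_kronecker_one, Matrix.submatrix_one_equiv]

variable {n L M : ℕ}

theorem encode_injective : Function.Injective (encode (n := n)) := by
  intro u v h
  have := congrArg (fun x => Matrix.vecMul x (polarMatrix n)) h
  simpa [encode, Matrix.vecMul_vecMul, polarMatrix_mul_self] using this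

theorem encode_add (u v : Fin (2 ^ n) → ZMod 2) : encode (u + v) = encode u + encode v :=
  Matrix.add_vecMul _ _ _

/-! ### Sign flips -/

/-- The sign `(-1) ^ b` of a bit. -/
noncomputable def bitSign (b : ZMod 2) : ℝ := 1 - 2 * (b.val : ℝ)

theorem bitSign_sq (b : ZMod 2) : bitSign b ^ 2 = 1 := by
  fin_cases b <;> norm_num [bitSign, ZMod.val]

theorem bpsk_add (Es : ℝ) (a b : ZMod 2) : bpsk Es (a + b) = bitSign a * bpsk Es b := by
  have h2 : (1 + 1 : ZMod 2) = 0 := by decide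
  have h1 : (1 : ZMod 2).val = 1 := by decide
  have ha : a = 0 ∨ a = 1 := by revert a; decide
  have hb : b = 0 ∨ b = 1 := by revert b; decide
  rcases ha with rfl | rfl <;> rcases hb with rfl | rfl <;>
    simp [bpsk, bitSign, h2, h1] <;> ring

/-- Multiplication of a signal by the signs of a codeword. -/
noncomputable def flip (hN : L * M = 2 ^ n) (x : Fin (2 ^ n) → ZMod 2)
    (y : Fin L → Fin M → ℝ) : Fin L → Fin M → ℝ :=
  fun l k => bitSign (toBlocks hN x l k) * y l k

theorem toBlocks_add (hN : L * M = 2 ^ n) (x c : Fin (2 ^ n) → ZMod 2) (l : Fin L) (k : Fin M) :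
    toBlocks hN (x + c) l k = toBlocks hN x l k + toBlocks hN c l k := rfl

theorem flip_received (hN : L * M = 2 ^ n) (Es : ℝ) (x c : Fin (2 ^ n) → ZMod 2)
    (α : Fin L → ℝ) (z : Fin L → Fin M → ℝ) :
    flip hN x (received hN Es c α z) = received hN Es (x + c) α (flip hN x z) := by
  funext l k
  simp only [flip, received, toBlocks_add, bpsk_add]
  ring

theorem transition_flip (hN : L * M = 2 ^ n) (Es N0 : ℝ) (α : Fin L → ℝ)
    (y : Fin L → Fin M → ℝ) (x c : Fin (2 ^ n) → ZMod 2) :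
    transition hN Es N0 α (flip hN x y) (x + c) = transition hN Es N0 α y c := by
  simp only [transition]
  congr 1
  refine Finset.prod_congr rfl fun l _ => Finset.prod_congr rfl fun k _ => ?_
  rw [toBlocks_add, bpsk_add, flip]
  congr 3
  rw [show bitSign (toBlocks hN x l k) * y l k
    - α l * (bitSign (toBlocks hN x l k) * bpsk Es (toBlocks hN c l k))
    = bitSign (toBlocks hN x l k) * (y l k - α l * bpsk Es (toBlocks hN c l k)) by ring,
    mul_pow, bitSign_sq, one_mul]

/-- The law of the noise. -/
noncomputable def noiseLaw (L M : ℕ) (N0 : ℝ) : Measure (Fin L → Fin M → ℝ) :=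
  Measure.pi fun _ : Fin L => Measure.pi fun _ : Fin M => gaussianReal 0 (N0 / 2).toNNReal

instance (N0 : ℝ) : IsProbabilityMeasure (noiseLaw L M N0) := by
  unfold noiseLaw; infer_instance

theorem measurePreserving_flip (hN : L * M = 2 ^ n) (N0 : ℝ) (x : Fin (2 ^ n) → ZMod 2) :
    MeasurePreserving (flip hN x) (noiseLaw L M N0) (noiseLaw L M N0) := by
  refine measurePreserving_pi _ _ fun l => measurePreserving_pi _ _ fun k =>
    ⟨measurable_const_mul _, ?_⟩
  rw [gaussianReal_map_const_mul]
  congr 1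
  · simp
  · ext; simp [bitSign_sq]

/-! ### Cosets and the error events -/

/-- The inputs starting with `i` zeros followed by the bit `b`. -/
def inputCoset (i : Fin (2 ^ n)) (b : ZMod 2) : Finset (Fin (2 ^ n) → ZMod 2) :=
  Finset.univ.filter fun u => (∀ j, j < i → u j = 0) ∧ u i = b

theorem mem_inputCoset {i : Fin (2 ^ n)} {b : ZMod 2} {u : Fin (2 ^ n) → ZMod 2} :
    u ∈ inputCoset i b ↔ (∀ j, j < i → u j = 0) ∧ u i = b := by simp [inputCoset]

/-- The sum of the likelihoods of the codewords with inputs in a coset. -/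
noncomputable def cosetLikelihood (hN : L * M = 2 ^ n) (Es N0 : ℝ) (i : Fin (2 ^ n)) (b : ZMod 2)
    (α : Fin L → ℝ) (y : Fin L → Fin M → ℝ) : ℝ :=
  ∑ w ∈ inputCoset i b, transition hN Es N0 α y (encode w)

theorem add_self_bits (u : Fin (2 ^ n) → ZMod 2) : u + u = 0 := by
  funext j; exact CharTwo.add_self_eq_zero _

/-- Translation by the true input `u` carries the inputs that agree with it before `i` to those that
vanish there, and the sign flip compensates in the likelihood. -/
theorem polarized_eq (hN : L * M = 2 ^ n) (Es N0 : ℝ) (i : Fin (2 ^ n)) (b : ZMod 2)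
    (α : Fin L → ℝ) (y : Fin L → Fin M → ℝ) (u v : Fin (2 ^ n) → ZMod 2)
    (huv : ∀ j, j < i → v j = u j) :
    polarized hN Es N0 α y i v b = 1 / 2 ^ (2 ^ n - 1) *
      cosetLikelihood hN Es N0 i (u i + b) α (flip hN (encode u) y) := by
  rw [polarized, cosetLikelihood]
  congr 1
  refine Finset.sum_nbij' (fun w => u + w) (fun w => u + w) ?_ ?_ ?_ ?_ ?_
  · intro w hw
    simp only [Finset.mem_filter, Finset.mem_univ, true_and] at hw
    refine mem_inputCoset.2 ⟨fun j hj => ?_, by simp [hw.2]⟩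
    simp [hw.1 j hj, huv j hj, CharTwo.add_self_eq_zero]
  · intro w hw
    obtain ⟨h1, h2⟩ := mem_inputCoset.1 hw
    simp only [Finset.mem_filter, Finset.mem_univ, true_and]
    refine ⟨fun j hj => by simp [h1 j hj, huv j hj], ?_⟩
    simp [h2, ← add_assoc, CharTwo.add_self_eq_zero]
  · intro w _; simp only [← add_assoc, add_self_bits, zero_add]
  · intro w _; simp only [← add_assoc, add_self_bits, zero_add]
  · intro w _; rw [encode_add, transition_flip]

theorem sum_inputCoset_add {i : Fin (2 ^ n)} {b : ZMod 2} {v : Fin (2 ^ n) → ZMod 2}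
    (hv : v ∈ inputCoset i 0) {R : Type*} [AddCommMonoid R] (f : (Fin (2 ^ n) → ZMod 2) → R) :
    ∑ w ∈ inputCoset i b, f (v + w) = ∑ w ∈ inputCoset i b, f w := by
  obtain ⟨h1, h2⟩ := mem_inputCoset.1 hv
  have hmem : ∀ w ∈ inputCoset i b, v + w ∈ inputCoset i b := fun w hw => by
    obtain ⟨h3, h4⟩ := mem_inputCoset.1 hw
    exact mem_inputCoset.2 ⟨fun j hj => by simp [h1 j hj, h3 j hj], by simp [h2, h4]⟩
  exact Finset.sum_nbij' (fun w => v + w) (fun w => v + w) hmem hmem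
    (fun w _ => by simp only [← add_assoc, add_self_bits, zero_add])
    (fun w _ => by simp only [← add_assoc, add_self_bits, zero_add]) fun w _ => rfl

/-- `inputCoset i 0` is a group and `inputCoset i b` is a coset of it, so the flip only permutes the
terms. -/
theorem cosetLikelihood_flip (hN : L * M = 2 ^ n) (Es N0 : ℝ) (i : Fin (2 ^ n)) (b : ZMod 2)
    (α : Fin L → ℝ) (y : Fin L → Fin M → ℝ) {u : Fin (2 ^ n) → ZMod 2}
    (hu : u ∈ inputCoset i 0) :
    cosetLikelihood hN Es N0 i b α (flip hN (encode u) y)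
      = cosetLikelihood hN Es N0 i b α y := by
  rw [cosetLikelihood, cosetLikelihood, ← sum_inputCoset_add hu]
  refine Finset.sum_congr rfl fun w _ => ?_
  rw [encode_add, transition_flip]

/-- The pairs of fading and noise for which, the all-zero codeword being sent, the `i`-th bit is
at least as likely to be `1` as `0`. -/
def bitErrorEvent (hN : L * M = 2 ^ n) (Es N0 : ℝ) (i : Fin (2 ^ n)) :
    Set ((Fin L → ℝ) × (Fin L → Fin M → ℝ)) :=
  {p | cosetLikelihood hN Es N0 i 0 p.1 (received hN Es 0 p.1 p.2)
    ≤ cosetLikelihood hN Es N0 i 1 p.1 (received hN Es 0 p.1 p.2)}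

theorem exists_first_error (hN : L * M = 2 ^ n) (Es N0 : ℝ) (A : Finset (Fin (2 ^ n)))
    (frozen u : Fin (2 ^ n) → ZMod 2) (hu : ∀ i, i ∉ A → u i = frozen i)
    (α : Fin L → ℝ) (y : Fin L → Fin M → ℝ) (h : scDecode hN Es N0 A frozen α y ≠ u) :
    ∃ i ∈ A, cosetLikelihood hN Es N0 i 0 α (flip hN (encode u) y)
      ≤ cosetLikelihood hN Es N0 i 1 α (flip hN (encode u) y) := by
  have hne : ∃ i, scDecode hN Es N0 A frozen α y i ≠ u i := by
    by_contra! hc; exact h (funext hc)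
  obtain ⟨i, hi, hmin⟩ := WellFounded.has_min (wellFounded_lt (α := Fin (2 ^ n)))
    {i | scDecode hN Es N0 A frozen α y i ≠ u i} hne
  have hlt : ∀ j, j < i → scDecode hN Es N0 A frozen α y j = u j := fun j hj => by
    by_contra hc; exact hmin j hc hj
  have hp : (0 : ℝ) < 1 / 2 ^ (2 ^ n - 1) := by positivity
  have hi' : scDecode hN Es N0 A frozen α y i ≠ u i := hi
  rw [scDecode] at hi'
  by_cases hA : i ∈ A
  · refine ⟨i, hA, ?_⟩
    simp only [hA, if_true] at hi'
    have hpol (b : ZMod 2) := polarized_eq hN Es N0 i b α y u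
      (fun j => if _h : j < i then scDecode hN Es N0 A frozen α y j else 0)
      (fun j hj => by simp [hj, hlt j hj])
    simp only [hpol, mul_le_mul_iff_right₀ hp] at hi'
    have hb : u i = 0 ∨ u i = 1 := by generalize u i = a; revert a; decide
    have h2 : (1 + 1 : ZMod 2) = 0 := by decide
    -- For a true bit `1` the two cosets swap roles. A tie is then decoded wrongly, hence the
    -- non-strict inequality in the conclusion.
    rcases hb with hb | hb <;> simp only [hb, zero_add, add_zero, h2] at hi' <;> split_ifs at hi'
    · exact absurd rfl hi'
    · linarith
    · assumption
    · exact absurd rfl hi'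
  · simp only [hA, if_false] at hi'
    exact absurd (hu i hA).symm hi'

/-! ### Densities of the received signal -/

/-- The density of the noise. -/
noncomputable def noiseDensity (N0 : ℝ) (z : Fin L → Fin M → ℝ) : ℝ :=
  ∏ l, ∏ k, gaussianPDFReal 0 (N0 / 2).toNNReal (z l k)

theorem noiseDensity_nonneg (N0 : ℝ) (z : Fin L → Fin M → ℝ) : 0 ≤ noiseDensity N0 z :=
  Finset.prod_nonneg fun _ _ => Finset.prod_nonneg fun _ _ => gaussianPDFReal_nonneg _ _ _

theorem noiseLaw_eq_withDensity {N0 : ℝ} (hN0 : 0 < N0) :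
    noiseLaw L M N0 = volume.withDensity fun z => ENNReal.ofReal (noiseDensity N0 z) := by
  have hv : (N0 / 2).toNNReal ≠ 0 := by simpa using hN0
  have h1 : (Measure.pi fun _ : Fin M => gaussianReal 0 (N0 / 2).toNNReal)
      = volume.withDensity fun z : Fin M → ℝ =>
        ENNReal.ofReal (∏ k, gaussianPDFReal 0 (N0 / 2).toNNReal (z k)) := by
    rw [gaussianReal_of_var_ne_zero _ hv]
    exact pi_withDensity_ofReal (fun _ : Fin M => (volume : Measure ℝ)) _
      (fun _ => gaussianPDFReal_nonneg _ _) (fun _ => integrable_gaussianPDFReal _ _)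
  unfold noiseLaw
  rw [h1]
  exact pi_withDensity_ofReal (fun _ : Fin L => (volume : Measure (Fin M → ℝ))) _
    (fun _ z => Finset.prod_nonneg fun _ _ => gaussianPDFReal_nonneg _ _ _)
    (fun _ => Integrable.fintype_prod fun _ => integrable_gaussianPDFReal _ _)

theorem lintegral_noiseDensity {N0 : ℝ} (hN0 : 0 < N0) :
    ∫⁻ z : Fin L → Fin M → ℝ, ENNReal.ofReal (noiseDensity N0 z) = 1 := by
  rw [← setLIntegral_univ, ← withDensity_apply _ MeasurableSet.univ,
    ← noiseLaw_eq_withDensity hN0, measure_univ]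

/-- The noiseless received signal. -/
noncomputable def fadedSignal (hN : L * M = 2 ^ n) (Es : ℝ) (x : Fin (2 ^ n) → ZMod 2)
    (α : Fin L → ℝ) : Fin L → Fin M → ℝ :=
  fun l k => α l * bpsk Es (toBlocks hN x l k)

theorem received_eq (hN : L * M = 2 ^ n) (Es : ℝ) (x : Fin (2 ^ n) → ZMod 2)
    (α : Fin L → ℝ) (z : Fin L → Fin M → ℝ) :
    received hN Es x α z = fadedSignal hN Es x α + z := rfl

theorem transition_eq (hN : L * M = 2 ^ n) (Es : ℝ) {N0 : ℝ} (hN0 : 0 < N0) (α : Fin L → ℝ)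
    (y : Fin L → Fin M → ℝ) (x : Fin (2 ^ n) → ZMod 2) :
    transition hN Es N0 α y x = noiseDensity N0 (y - fadedSignal hN Es x α) := by
  have hv : (((N0 / 2).toNNReal : NNReal) : ℝ) = N0 / 2 := Real.coe_toNNReal _ (by positivity)
  have h2 : (2 : ℝ) ^ n = ((L * M : ℕ) : ℝ) := by rw [hN]; simp
  have hc : (1 / (Real.pi * N0) ^ ((2 ^ n : ℝ) / 2))
      = ∏ _l : Fin L, ∏ _k : Fin M, (√(Real.pi * N0))⁻¹ := by
    simp only [Finset.prod_const, Finset.card_univ, Fintype.card_fin]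
    rw [h2, ← pow_mul, inv_pow, one_div, mul_comm M L, Real.sqrt_eq_rpow, ← Real.rpow_natCast,
      ← Real.rpow_mul (by positivity)]
    congr 2
    ring
  rw [transition, hc, noiseDensity, ← Finset.prod_mul_distrib]
  refine Finset.prod_congr rfl fun l _ => ?_
  rw [← Finset.prod_mul_distrib]
  refine Finset.prod_congr rfl fun k _ => ?_
  rw [gaussianPDFReal, hv]
  congr 1
  · congr 2; ring
  · congr 1
    simp only [fadedSignal, Pi.sub_apply, sub_zero]
    rw [show 2 * (N0 / 2) = N0 by ring, neg_div]

theorem noiseLaw_received_preimage (hN : L * M = 2 ^ n) (Es : ℝ) {N0 : ℝ} (hN0 : 0 < N0)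
    (α : Fin L → ℝ) (x : Fin (2 ^ n) → ZMod 2) {E : Set (Fin L → Fin M → ℝ)}
    (hE : MeasurableSet E) :
    noiseLaw L M N0 {z | received hN Es x α z ∈ E}
      = ∫⁻ y in E, ENNReal.ofReal (transition hN Es N0 α y x) := by
  have hm : MeasurableSet {z | received hN Es x α z ∈ E} := by
    simp only [received_eq]
    exact measurable_const_add _ hE
  rw [noiseLaw_eq_withDensity hN0, withDensity_apply _ hm, ← lintegral_indicator hm,
    ← lintegral_indicator hE, ← lintegral_sub_right_eq_self _ (fadedSignal hN Es x α)]
  refine lintegral_congr fun y => ?_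
  have hiff : y - fadedSignal hN Es x α ∈ {z | received hN Es x α z ∈ E} ↔ y ∈ E := by
    simp only [Set.mem_ofPred_eq, received_eq, add_sub_cancel]
  by_cases hy : y ∈ E
  · rw [Set.indicator_of_mem hy, Set.indicator_of_mem (hiff.2 hy), transition_eq hN Es hN0]
  · rw [Set.indicator_of_notMem hy, Set.indicator_of_notMem (mt hiff.1 hy)]

/-! ### Bhattacharyya coefficients -/

/-- By the parallelogram law, the geometric mean of two Gaussian densities is the density at the
midpoint times a factor depending only on the difference, so it integrates explicitly. -/
theorem gaussianPDFReal_mul_eq_sq {N0 : ℝ} (hN0 : 0 < N0) (a b : ℝ) :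
    gaussianPDFReal 0 (N0 / 2).toNNReal a * gaussianPDFReal 0 (N0 / 2).toNNReal b
      = (gaussianPDFReal 0 (N0 / 2).toNNReal ((a + b) / 2)
        * Real.exp (-((a - b) ^ 2 / (4 * N0)))) ^ 2 := by
  have hv : (((N0 / 2).toNNReal : NNReal) : ℝ) = N0 / 2 := Real.coe_toNNReal _ (by positivity)
  simp only [gaussianPDFReal, hv, mul_pow, ← Real.exp_nat_mul]
  rw [mul_mul_mul_comm, ← Real.exp_add, ← sq,
    mul_assoc ((√(2 * Real.pi * (N0 / 2)))⁻¹ ^ 2), ← Real.exp_add]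
  congr 2
  field_simp
  ring

theorem sqrt_noiseDensity_mul {N0 : ℝ} (hN0 : 0 < N0) (a b : Fin L → Fin M → ℝ) :
    √(noiseDensity N0 a * noiseDensity N0 b)
      = noiseDensity N0 (fun l k => (a l k + b l k) / 2)
        * ∏ l, ∏ k, Real.exp (-((a l k - b l k) ^ 2 / (4 * N0))) := by
  rw [← Real.sqrt_sq (mul_nonneg (noiseDensity_nonneg N0 fun l k => (a l k + b l k) / 2)
    (Finset.prod_nonneg fun l _ => Finset.prod_nonneg fun k _ => (Real.exp_pos _).le))]
  congr 1
  simp only [noiseDensity, ← Finset.prod_mul_distrib, gaussianPDFReal_mul_eq_sq hN0,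
    Finset.prod_pow]

theorem bpsk_sub_add_sq {Es : ℝ} (hEs : 0 ≤ Es) (a c : ZMod 2) :
    (bpsk Es (a + c) - bpsk Es a) ^ 2 = if c ≠ 0 then 4 * Es else 0 := by
  have h1 : (1 : ZMod 2).val = 1 := by decide
  have hb : bpsk Es a ^ 2 = Es := by
    have : bpsk Es a = √Es * bitSign a := rfl
    rw [this, mul_pow, bitSign_sq, Real.sq_sqrt hEs, mul_one]
  have hc : c = 0 ∨ c = 1 := by revert c; decide
  rcases hc with rfl | rfl
  · simp
  · rw [add_comm, bpsk_add, if_pos one_ne_zero]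
    have : bitSign 1 = -1 := by norm_num [bitSign, h1]
    rw [this]
    linear_combination 4 * hb

theorem lintegral_sqrt_transition_mul (hN : L * M = 2 ^ n) {Es N0 : ℝ} (hEs : 0 < Es)
    (hN0 : 0 < N0) (α : Fin L → ℝ) (x c : Fin (2 ^ n) → ZMod 2) :
    ∫⁻ y, ENNReal.ofReal (√(transition hN Es N0 α y x * transition hN Es N0 α y (x + c)))
      = ENNReal.ofReal
        (∏ l, Real.exp (-(hammingNorm (toBlocks hN c l) * (Es / N0) * α l ^ 2))) := by
  have hpt (y : Fin L → Fin M → ℝ) :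
      √(transition hN Es N0 α y x * transition hN Es N0 α y (x + c))
        = noiseDensity N0 (y - fun l k =>
            (fadedSignal hN Es x α l k + fadedSignal hN Es (x + c) α l k) / 2)
          * ∏ l, Real.exp (-(hammingNorm (toBlocks hN c l) * (Es / N0) * α l ^ 2)) := by
    rw [transition_eq hN Es hN0, transition_eq hN Es hN0, sqrt_noiseDensity_mul hN0]
    congr 1
    · congr 1
      funext l k
      simp only [Pi.sub_apply]
      ring
    · refine Finset.prod_congr rfl fun l _ => ?_
      rw [← Real.exp_sum]
      congr 1
      -- Where the codewords differ, the signals are `2 α_l √E_s` apart; the square over `4 N₀` is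
      -- `(E_s / N₀) α_l²`.
      have (k : Fin M) : -(((y - fadedSignal hN Es x α) l k
          - (y - fadedSignal hN Es (x + c) α) l k) ^ 2 / (4 * N0))
          = if toBlocks hN c l k ≠ 0 then -(Es / N0 * α l ^ 2) else 0 := by
        simp only [Pi.sub_apply, fadedSignal, toBlocks_add, sub_sub_sub_cancel_left]
        rw [← mul_sub, mul_pow, bpsk_sub_add_sq hEs.le]
        split_ifs
        · field_simp
        · simp
      rw [Finset.sum_congr rfl fun k _ => this k, ← Finset.sum_filter, Finset.sum_const,
        nsmul_eq_mul, hammingNorm]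
      ring
  simp only [hpt, ENNReal.ofReal_mul (noiseDensity_nonneg _ _)]
  rw [lintegral_mul_const' _ _ ENNReal.ofReal_ne_top,
    lintegral_sub_right_eq_self fun y => ENNReal.ofReal (noiseDensity N0 y),
    lintegral_noiseDensity hN0, one_mul]

/-! ### The conditional probability of a bit error -/

theorem transition_nonneg (hN : L * M = 2 ^ n) (Es : ℝ) {N0 : ℝ} (hN0 : 0 < N0) (α : Fin L → ℝ)
    (y : Fin L → Fin M → ℝ) (x : Fin (2 ^ n) → ZMod 2) : 0 ≤ transition hN Es N0 α y x := by
  rw [transition_eq hN Es hN0]; exact noiseDensity_nonneg _ _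

theorem cosetLikelihood_nonneg (hN : L * M = 2 ^ n) (Es : ℝ) {N0 : ℝ} (hN0 : 0 < N0)
    (i : Fin (2 ^ n)) (b : ZMod 2) (α : Fin L → ℝ) (y : Fin L → Fin M → ℝ) :
    0 ≤ cosetLikelihood hN Es N0 i b α y :=
  Finset.sum_nonneg fun _ _ => transition_nonneg hN Es hN0 α y _

theorem sqrt_sum_le_sum_sqrt {ι : Type*} (s : Finset ι) (f : ι → ℝ) (hf : ∀ i, 0 ≤ f i) :
    √(∑ i ∈ s, f i) ≤ ∑ i ∈ s, √(f i) := by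
  classical
  induction s using Finset.induction_on with
  | empty => simp
  | insert a s ha ih =>
    rw [Finset.sum_insert ha, Finset.sum_insert ha]
    have hs : 0 ≤ ∑ i ∈ s, f i := Finset.sum_nonneg fun i _ => hf i
    refine le_trans (Real.sqrt_le_iff.2 ⟨by positivity, ?_⟩) (add_le_add_right ih _)
    rw [add_sq, Real.sq_sqrt (hf a), Real.sq_sqrt hs]
    have : 0 ≤ 2 * √(f a) * √(∑ i ∈ s, f i) := by positivity
    linarith

theorem cosetLikelihood_le_sum_sqrt (hN : L * M = 2 ^ n) (Es : ℝ) {N0 : ℝ} (hN0 : 0 < N0)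
    (i : Fin (2 ^ n)) (α : Fin L → ℝ) (y : Fin L → Fin M → ℝ)
    (h : cosetLikelihood hN Es N0 i 0 α y ≤ cosetLikelihood hN Es N0 i 1 α y) :
    cosetLikelihood hN Es N0 i 0 α y ≤ ∑ v ∈ inputCoset i 0, ∑ w ∈ inputCoset i 1,
      √(transition hN Es N0 α y (encode v) * transition hN Es N0 α y (encode w)) := by
  have h0 := cosetLikelihood_nonneg hN Es hN0 i 0 α y
  calc cosetLikelihood hN Es N0 i 0 α y
      = √(cosetLikelihood hN Es N0 i 0 α y) * √(cosetLikelihood hN Es N0 i 0 α y) :=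
        (Real.mul_self_sqrt h0).symm
    _ ≤ √(cosetLikelihood hN Es N0 i 0 α y) * √(cosetLikelihood hN Es N0 i 1 α y) := by gcongr
    _ ≤ (∑ v ∈ inputCoset i 0, √(transition hN Es N0 α y (encode v)))
        * ∑ w ∈ inputCoset i 1, √(transition hN Es N0 α y (encode w)) := by
        gcongr <;> exact sqrt_sum_le_sum_sqrt _ _ fun _ => transition_nonneg hN Es hN0 α y _
    _ = _ := by
        rw [Finset.sum_mul_sum]
        exact Finset.sum_congr rfl fun v _ => Finset.sum_congr rfl fun w _ =>
          (Real.sqrt_mul (transition_nonneg hN Es hN0 α y _) _).symm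

theorem continuous_cosetLikelihood (hN : L * M = 2 ^ n) (Es N0 : ℝ)
    (i : Fin (2 ^ n)) (b : ZMod 2) :
    Continuous fun p : (Fin L → ℝ) × (Fin L → Fin M → ℝ) =>
      cosetLikelihood hN Es N0 i b p.1 p.2 := by
  unfold cosetLikelihood transition
  fun_prop

theorem measurableSet_bitErrorEvent (hN : L * M = 2 ^ n) (Es N0 : ℝ) (i : Fin (2 ^ n)) :
    MeasurableSet (bitErrorEvent hN Es N0 i) := by
  have hr : Continuous fun p : (Fin L → ℝ) × (Fin L → Fin M → ℝ) =>
      (p.1, received hN Es 0 p.1 p.2) := by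
    unfold received
    fun_prop
  exact (isClosed_le ((continuous_cosetLikelihood hN Es N0 i 0).comp hr)
    ((continuous_cosetLikelihood hN Es N0 i 1).comp hr)).measurableSet

/-- The received signals for which the `i`-th bit is at least as likely to be `1` as `0`, the
previous bits being `0`. -/
def bitErrorRegion (hN : L * M = 2 ^ n) (Es N0 : ℝ) (i : Fin (2 ^ n)) (α : Fin L → ℝ) :
    Set (Fin L → Fin M → ℝ) :=
  {y | cosetLikelihood hN Es N0 i 0 α y ≤ cosetLikelihood hN Es N0 i 1 α y}

theorem measurableSet_bitErrorRegion (hN : L * M = 2 ^ n) (Es N0 : ℝ) (i : Fin (2 ^ n))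
    (α : Fin L → ℝ) : MeasurableSet (bitErrorRegion hN Es N0 i α) := by
  have hcont (b : ZMod 2) : Continuous fun y : Fin L → Fin M → ℝ =>
      cosetLikelihood hN Es N0 i b α y := by
    unfold cosetLikelihood transition
    fun_prop
  exact (isClosed_le (hcont 0) (hcont 1)).measurableSet

theorem continuous_transition (hN : L * M = 2 ^ n) (Es N0 : ℝ) (α : Fin L → ℝ)
    (x : Fin (2 ^ n) → ZMod 2) :
    Continuous fun y : Fin L → Fin M → ℝ => transition hN Es N0 α y x := by
  unfold transition; fun_prop

/-- All codewords of the coset of `0` have the same error probability. -/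
theorem noiseLaw_bitErrorEvent_eq (hN : L * M = 2 ^ n) (Es : ℝ) {N0 : ℝ} (hN0 : 0 < N0)
    (i : Fin (2 ^ n)) (α : Fin L → ℝ) {v : Fin (2 ^ n) → ZMod 2} (hv : v ∈ inputCoset i 0) :
    noiseLaw L M N0 {z | (α, z) ∈ bitErrorEvent hN Es N0 i}
      = ∫⁻ y in bitErrorRegion hN Es N0 i α,
        ENNReal.ofReal (transition hN Es N0 α y (encode v)) := by
  rw [← noiseLaw_received_preimage hN Es hN0 α (encode v) (measurableSet_bitErrorRegion ..)]
  have hm : MeasurableSet {z : Fin L → Fin M → ℝ | (α, z) ∈ bitErrorEvent hN Es N0 i} :=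
    (measurableSet_bitErrorEvent hN Es N0 i).preimage measurable_prodMk_left
  -- Flipping the noise by the codeword of `v` replaces the all-zero transmission by that of `v`;
  -- the error region is invariant under this flip.
  rw [← (measurePreserving_flip hN N0 (encode v)).measure_preimage hm.nullMeasurableSet]
  congr 1
  ext z
  simp only [Set.mem_preimage, Set.mem_ofPred_eq, bitErrorEvent, bitErrorRegion]
  have : received hN Es 0 α (flip hN (encode v) z)
      = flip hN (encode v) (received hN Es (encode v) α z) := by
    rw [flip_received, add_self_bits]
  rw [this, cosetLikelihood_flip hN Es N0 i 0 α _ hv, cosetLikelihood_flip hN Es N0 i 1 α _ hv]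

/-- The Bhattacharyya coefficient of the all-zero codeword and the codeword `c`. -/
noncomputable def bhattacharyya (hN : L * M = 2 ^ n) (Es N0 : ℝ) (α : Fin L → ℝ)
    (c : Fin (2 ^ n) → ZMod 2) : ℝ :=
  ∏ l, Real.exp (-(hammingNorm (toBlocks hN c l) * (Es / N0) * α l ^ 2))

theorem sum_lintegral_sqrt_transition (hN : L * M = 2 ^ n) {Es N0 : ℝ} (hEs : 0 < Es)
    (hN0 : 0 < N0) (i : Fin (2 ^ n)) (α : Fin L → ℝ) {v : Fin (2 ^ n) → ZMod 2}
    (hv : v ∈ inputCoset i 0) :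
    ∑ w ∈ inputCoset i 1, ∫⁻ y, ENNReal.ofReal
        (√(transition hN Es N0 α y (encode v) * transition hN Es N0 α y (encode w)))
      = ∑ w ∈ inputCoset i 1, ENNReal.ofReal (bhattacharyya hN Es N0 α (encode w)) := by
  rw [← sum_inputCoset_add hv]
  refine Finset.sum_congr rfl fun w _ => ?_
  rw [encode_add, lintegral_sqrt_transition_mul hN hEs hN0, bhattacharyya]

theorem lintegral_cosetLikelihood_le (hN : L * M = 2 ^ n) {Es N0 : ℝ}
    (hN0 : 0 < N0) (i : Fin (2 ^ n)) (α : Fin L → ℝ) :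
    ∫⁻ y in bitErrorRegion hN Es N0 i α, ENNReal.ofReal (cosetLikelihood hN Es N0 i 0 α y)
      ≤ ∑ v ∈ inputCoset i 0, ∑ w ∈ inputCoset i 1, ∫⁻ y, ENNReal.ofReal
        (√(transition hN Es N0 α y (encode v) * transition hN Es N0 α y (encode w))) := by
  have hm (v w : Fin (2 ^ n) → ZMod 2) : Measurable fun y : Fin L → Fin M → ℝ =>
      ENNReal.ofReal (√(transition hN Es N0 α y (encode v)
        * transition hN Es N0 α y (encode w))) :=
    (((continuous_transition hN Es N0 α _).mul
      (continuous_transition hN Es N0 α _)).sqrt).measurable.ennreal_ofReal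
  have hsum : ∑ v ∈ inputCoset i 0, ∑ w ∈ inputCoset i 1, ∫⁻ y, ENNReal.ofReal
        (√(transition hN Es N0 α y (encode v) * transition hN Es N0 α y (encode w)))
      = ∫⁻ y, ∑ v ∈ inputCoset i 0, ∑ w ∈ inputCoset i 1, ENNReal.ofReal
        (√(transition hN Es N0 α y (encode v) * transition hN Es N0 α y (encode w))) := by
    rw [lintegral_finsetSum _ fun v _ => Finset.measurable_sum _ fun w _ => hm v w]
    exact Finset.sum_congr rfl fun v _ => (lintegral_finsetSum _ fun w _ => hm v w).symm
  rw [hsum]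
  -- The error inequality is used only pointwise on the region; the nonnegative integrand is then
  -- extended to all signals.
  refine (setLIntegral_mono' (measurableSet_bitErrorRegion hN Es N0 i α) fun y hy => ?_).trans
    (setLIntegral_le_lintegral _ _)
  refine (ENNReal.ofReal_le_ofReal
    (cosetLikelihood_le_sum_sqrt hN Es hN0 i α y hy)).trans_eq ?_
  rw [ENNReal.ofReal_sum_of_nonneg fun v _ => Finset.sum_nonneg fun w _ => Real.sqrt_nonneg _]
  exact Finset.sum_congr rfl fun v _ =>
    ENNReal.ofReal_sum_of_nonneg fun w _ => Real.sqrt_nonneg _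

theorem noiseLaw_bitErrorEvent_le (hN : L * M = 2 ^ n) {Es N0 : ℝ} (hEs : 0 < Es)
    (hN0 : 0 < N0) (i : Fin (2 ^ n)) (α : Fin L → ℝ) :
    noiseLaw L M N0 {z | (α, z) ∈ bitErrorEvent hN Es N0 i}
      ≤ ∑ w ∈ inputCoset i 1, ENNReal.ofReal (bhattacharyya hN Es N0 α (encode w)) := by
  have h0 : (inputCoset i 0).card ≠ 0 :=
    Finset.card_ne_zero_of_mem (mem_inputCoset.2 ⟨fun _ _ => rfl, rfl⟩ : 0 ∈ inputCoset i 0)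
  -- Multiplying by the size of the zero coset turns the averages over `v` into sums.
  refine (ENNReal.mul_le_mul_iff_right (Nat.cast_ne_zero.2 h0) (ENNReal.natCast_ne_top _)).1 ?_
  rw [← nsmul_eq_mul, ← nsmul_eq_mul, ← Finset.sum_const, ← Finset.sum_const,
    Finset.sum_congr rfl fun v hv => noiseLaw_bitErrorEvent_eq hN Es hN0 i α hv,
    ← Finset.sum_congr rfl fun v hv => sum_lintegral_sqrt_transition hN hEs hN0 i α hv,
    ← lintegral_finsetSum _ fun v _ =>
      (continuous_transition hN Es N0 α _).measurable.ennreal_ofReal]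
  refine le_of_eq_of_le (lintegral_congr fun y => ?_) (lintegral_cosetLikelihood_le hN hN0 i α)
  rw [cosetLikelihood, ENNReal.ofReal_sum_of_nonneg
    fun v _ => transition_nonneg hN Es hN0 α y _]

/-! ### Rayleigh fading -/

theorem rayleighPDF_nonneg {σ : ℝ} (a : ℝ) : 0 ≤ rayleighPDF σ a := by
  unfold rayleighPDF; split_ifs <;> positivity

theorem measurable_rayleighPDF (σ : ℝ) : Measurable (rayleighPDF σ) := by
  unfold rayleighPDF
  exact Measurable.ite measurableSet_Ici (by fun_prop) measurable_const

theorem integral_mul_exp_neg_mul_sq {b : ℝ} (hb : 0 < b) :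
    ∫ a in Set.Ioi (0 : ℝ), a * Real.exp (-b * a ^ 2) = (2 * b)⁻¹ := by
  have h := integral_mul_cexp_neg_mul_sq (b := (b : ℂ)) (by simpa using hb)
  have h2 : ((∫ a in Set.Ioi (0 : ℝ), a * Real.exp (-b * a ^ 2) : ℝ) : ℂ) = ((2 * b)⁻¹ : ℝ) := by
    rw [← integral_complex_ofReal]
    push_cast
    exact h
  exact_mod_cast h2

/-- With `2 σ² = 1` the squared fading is exponential of mean one, and this is its Laplace
transform. The case `t = 0` gives total mass one. -/
theorem lintegral_exp_rayleighMeasure {σ : ℝ} (hσ2 : 2 * σ ^ 2 = 1) {t : ℝ} (ht : 0 ≤ t) :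
    ∫⁻ a, ENNReal.ofReal (Real.exp (-(t * a ^ 2))) ∂(rayleighMeasure σ)
      = ENNReal.ofReal (1 / (t + 1)) := by
  have hb : 0 < t + 1 := by positivity
  have hpt (a : ℝ) : (ENNReal.ofReal (rayleighPDF σ a)) * ENNReal.ofReal (Real.exp (-(t * a ^ 2)))
      = (Set.Ici (0 : ℝ)).indicator
        (fun a => ENNReal.ofReal (2 * (a * Real.exp (-(t + 1) * a ^ 2)))) a := by
    rw [← ENNReal.ofReal_mul (rayleighPDF_nonneg a)]
    by_cases ha : 0 ≤ a
    · rw [Set.indicator_of_mem (Set.mem_Ici.2 ha), rayleighPDF, if_pos ha, hσ2, mul_assoc,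
        ← Real.exp_add, show σ ^ 2 = 1 / 2 by linarith]
      congr 1
      ring_nf
    · rw [Set.indicator_of_notMem (by simpa using ha), rayleighPDF, if_neg ha]
      simp
  rw [rayleighMeasure, lintegral_withDensity_eq_lintegral_mul _
    (measurable_rayleighPDF σ).ennreal_ofReal (by fun_prop)]
  simp only [Pi.mul_apply, hpt]
  rw [lintegral_indicator measurableSet_Ici, setLIntegral_congr Ioi_ae_eq_Ici.symm,
    ← ofReal_integral_eq_lintegral_ofReal
      ((integrable_mul_exp_neg_mul_sq hb).const_mul 2).integrableOn
      ((ae_restrict_iff' measurableSet_Ioi).2 (ae_of_all _ fun a ha => ?_)),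
    integral_const_mul, integral_mul_exp_neg_mul_sq hb]
  · congr 1
    field_simp
  · have : (0 : ℝ) < a := ha
    simp only [Pi.zero_apply]
    positivity

theorem isProbabilityMeasure_rayleighMeasure {σ : ℝ} (hσ2 : 2 * σ ^ 2 = 1) :
    IsProbabilityMeasure (rayleighMeasure σ) :=
  ⟨by simpa using lintegral_exp_rayleighMeasure hσ2 le_rfl⟩

theorem lintegral_bhattacharyya (hN : L * M = 2 ^ n) {σ Es N0 : ℝ} (hσ2 : 2 * σ ^ 2 = 1)
    (hEs : 0 < Es) (hN0 : 0 < N0) (c : Fin (2 ^ n) → ZMod 2) :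
    ∫⁻ α, ENNReal.ofReal (bhattacharyya hN Es N0 α c)
        ∂(Measure.pi fun _ : Fin L => rayleighMeasure σ)
      = ENNReal.ofReal
        (∏ l, 1 / ((hammingNorm (toBlocks hN c l) : ℝ) * (Es / N0) + 1)) := by
  have := isProbabilityMeasure_rayleighMeasure hσ2
  have ht (l : Fin L) : 0 ≤ (hammingNorm (toBlocks hN c l) : ℝ) * (Es / N0) := by positivity
  unfold bhattacharyya
  rw [lintegral_pi_ofReal_prod _
    (fun l a => Real.exp (-(hammingNorm (toBlocks hN c l) * (Es / N0) * a ^ 2)))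
    (fun _ _ => (Real.exp_pos _).le), ENNReal.ofReal_prod_of_nonneg]
  · exact Finset.prod_congr rfl fun l _ => lintegral_exp_rayleighMeasure hσ2 (ht l)
  · exact fun l _ => by positivity
  · intro l
    refine Integrable.of_bound (by fun_prop) 1 (ae_of_all _ fun a => ?_)
    rw [Real.norm_eq_abs, Real.abs_exp, Real.exp_le_one_iff]
    exact neg_nonpos.2 (mul_nonneg (ht l) (sq_nonneg a))

theorem channelLaw_eq (L M : ℕ) (σ N0 : ℝ) :
    channelLaw L M σ N0
      = (Measure.pi fun _ : Fin L => rayleighMeasure σ).prod (noiseLaw L M N0) := rfl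

theorem channelLaw_bitErrorEvent_le (hN : L * M = 2 ^ n) {σ Es N0 : ℝ} (hσ2 : 2 * σ ^ 2 = 1)
    (hEs : 0 < Es) (hN0 : 0 < N0) (i : Fin (2 ^ n)) :
    channelLaw L M σ N0 (bitErrorEvent hN Es N0 i)
      ≤ ENNReal.ofReal (∑ w ∈ inputCoset i 1,
        ∏ l, 1 / ((hammingNorm (toBlocks hN (encode w) l) : ℝ) * (Es / N0) + 1)) := by
  have := isProbabilityMeasure_rayleighMeasure hσ2
  rw [channelLaw_eq, Measure.prod_apply (measurableSet_bitErrorEvent hN Es N0 i),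
    ENNReal.ofReal_sum_of_nonneg fun w _ => Finset.prod_nonneg fun l _ => by positivity]
  simp only [← lintegral_bhattacharyya hN hσ2 hEs hN0]
  rw [← lintegral_finsetSum _ fun w _ => by unfold bhattacharyya; fun_prop]
  exact lintegral_mono fun α => noiseLaw_bitErrorEvent_le hN hEs hN0 i α

/-! ### Grouping codewords by their block weights -/

theorem sum_hammingNorm_toBlocks (hN : L * M = 2 ^ n) (c : Fin (2 ^ n) → ZMod 2) :
    ∑ l, hammingNorm (toBlocks hN c l) = hammingNorm c := by
  simp only [hammingNorm, Finset.card_filter]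
  rw [← Fintype.sum_prod_type',
    ← (finProdFinEquiv.trans (finCongr hN)).sum_comp (fun j => if c j ≠ 0 then 1 else 0)]
  rfl

theorem sum_polarSubcode_eq (hN : L * M = 2 ^ n) (i : Fin (2 ^ n)) (f : (Fin L → ℕ) → ℝ) :
    ∑ w ∈ inputCoset i 1, f (fun l => hammingNorm (toBlocks hN (encode w) l))
      = ∑ d ∈ weightPartitions L M i, (splitEnumerator hN i d : ℝ) * f d := by
  have himg : ∑ w ∈ inputCoset i 1, f (fun l => hammingNorm (toBlocks hN (encode w) l))
      = ∑ c ∈ polarSubcode i, f (fun l => hammingNorm (toBlocks hN c l)) := by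
    rw [polarSubcode, Finset.sum_image fun _ _ _ _ h => encode_injective h]
    rfl
  -- Every codeword of the subcode meets the weight constraints, so no term is lost when summing
  -- over `weightPartitions`.
  have hmaps : ∀ c ∈ polarSubcode i,
      (fun l => hammingNorm (toBlocks hN c l)) ∈ weightPartitions L M i := by
    intro c hc
    simp only [weightPartitions, Finset.mem_filter, Fintype.mem_piFinset, Finset.mem_range,
      sum_hammingNorm_toBlocks]
    refine ⟨fun l => Nat.lt_succ_of_le ?_, Nat.sInf_le ⟨c, hc, rfl⟩, ?_⟩
    · simpa using hammingNorm_le_card_fintype (x := toBlocks hN c l)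
    · simpa using hammingNorm_le_card_fintype (x := c)
  rw [himg, ← Finset.sum_fiberwise_of_maps_to hmaps]
  refine Finset.sum_congr rfl fun d _ => ?_
  rw [Finset.sum_congr rfl fun c hc => congrArg f (Finset.mem_filter.1 hc).2, Finset.sum_const,
    nsmul_eq_mul, splitEnumerator]
  simp only [funext_iff]

/-! ### The union bound -/

theorem decodingError_subset (hN : L * M = 2 ^ n) (Es N0 : ℝ) (A : Finset (Fin (2 ^ n)))
    (frozen : Fin (2 ^ n) → ZMod 2) (m : A → ZMod 2) :
    {p : (Fin L → ℝ) × (Fin L → Fin M → ℝ) | scDecode hN Es N0 A frozen p.1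
        (received hN Es (encode (sourceBlock A frozen m)) p.1 p.2) ≠ sourceBlock A frozen m}
      ⊆ ⋃ i ∈ A, Prod.map id (flip hN (encode (sourceBlock A frozen m))) ⁻¹'
        bitErrorEvent hN Es N0 i := by
  intro p hp
  obtain ⟨i, hi, h⟩ := exists_first_error hN Es N0 A frozen _
    (fun i hi => by simp [sourceBlock, hi]) p.1 _ hp
  rw [flip_received, add_self_bits] at h
  exact Set.mem_biUnion hi h

theorem channelLaw_decodingError_le (hN : L * M = 2 ^ n) {σ Es N0 : ℝ} (hσ2 : 2 * σ ^ 2 = 1)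
    (hEs : 0 < Es) (hN0 : 0 < N0) (A : Finset (Fin (2 ^ n)))
    (frozen : Fin (2 ^ n) → ZMod 2) (m : A → ZMod 2) :
    (channelLaw L M σ N0).real
        {p | scDecode hN Es N0 A frozen p.1
          (received hN Es (encode (sourceBlock A frozen m)) p.1 p.2) ≠ sourceBlock A frozen m}
      ≤ ∑ i ∈ A, ∑ d ∈ weightPartitions L M i,
        (splitEnumerator hN i d : ℝ) * ∏ l : Fin L, 1 / ((d l : ℝ) * (Es / N0) + 1) := by
  have := isProbabilityMeasure_rayleighMeasure hσ2
  have hpres : MeasurePreserving (Prod.map id (flip hN (encode (sourceBlock A frozen m))))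
      (channelLaw L M σ N0) (channelLaw L M σ N0) :=
    (MeasurePreserving.id _).prod (measurePreserving_flip hN N0 _)
  have hnn (i : Fin (2 ^ n)) : 0 ≤ ∑ d ∈ weightPartitions L M i,
      (splitEnumerator hN i d : ℝ) * ∏ l : Fin L, 1 / ((d l : ℝ) * (Es / N0) + 1) :=
    Finset.sum_nonneg fun d _ => mul_nonneg (Nat.cast_nonneg _)
      (Finset.prod_nonneg fun l _ => by positivity)
  refine ENNReal.toReal_le_of_le_ofReal (Finset.sum_nonneg fun i _ => hnn i) ?_
  -- Monotonicity holds for arbitrary sets, so measurability of the decoder is not needed.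
  refine (measure_mono (decodingError_subset hN Es N0 A frozen m)).trans
    ((measure_biUnion_finset_le _ _).trans ?_)
  rw [ENNReal.ofReal_sum_of_nonneg fun i _ => hnn i]
  refine Finset.sum_le_sum fun i _ => ?_
  rw [hpres.measure_preimage (measurableSet_bitErrorEvent hN Es N0 i).nullMeasurableSet,
    ← sum_polarSubcode_eq hN i fun d => ∏ l : Fin L, 1 / ((d l : ℝ) * (Es / N0) + 1)]
  exact channelLaw_bitErrorEvent_le hN hσ2 hEs hN0 i

end PolarBlockFading

theorem corollary2 (n K L M : ℕ) (hN : L * M = 2 ^ n)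
    (A : Finset (Fin (2 ^ n))) (hA : A.card = K) (frozen : Fin (2 ^ n) → ZMod 2)
    (σ Es N0 : ℝ) (hσ : 0 < σ) (hσ2 : 2 * σ ^ 2 = 1) (hEs : 0 < Es) (hN0 : 0 < N0) :
    PolarBlockFading.blockErrorProbability hN σ Es N0 A frozen ≤
      ∑ i ∈ A, ∑ d ∈ PolarBlockFading.weightPartitions L M i,
        (PolarBlockFading.splitEnumerator hN i d : ℝ) * ∏ l : Fin L, 1 / ((d l : ℝ) * (Es / N0) + 1) := by
  rw [PolarBlockFading.blockErrorProbability, div_le_iff₀ (by positivity)]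
  -- The bound does not depend on the message, so averaging over the `2 ^ A.card` messages preserves
  -- it.
  refine (Finset.sum_le_sum fun m _ =>
    PolarBlockFading.channelLaw_decodingError_le hN hσ2 hEs hN0 A frozen m).trans_eq ?_
  rw [Finset.sum_const, Finset.card_univ, Fintype.card_fun, ZMod.card, Fintype.card_coe,
    nsmul_eq_mul, mul_comm]
  norm_num
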